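/- Let $V=\{v_1,\dots,v_n\}$ be a finite set. An ordered constraint on $V$ is a sequence $\mathcal O=(v_{k_1},\dots,v_{k_s})$ of $s\ge 2$ distinct elements of $V$. A set $E$ of edges (two-element subsets of $V$) satisfies $\mathcal O$ if for every $2\le i\le s$ there is some $1\le j<i$ with $\{v_{k_j},v_{k_i}\}\in E$. In the (offline) Network Construction with Ordered Constraints problem the input is $V$ together with ordered constraints $\mathcal O_1,\dots,\mathcal O_r$ on $V$, and the task is to find a set $E$ of edges, with $|E|$ as small as possible, that satisfies all of them; let $\mathrm{OPT}$ denote the minimum of $|E|$ over all such sets. There are a constant $C>0$ and a deterministic polynomial-time algorithm (a single random access machine program whose number of steps is at most a fixed polynomial in the input size $n+\sum_{i=1}^r|\mathcal O_i|$) which, on every instance with $n$ vertices and $r$ ordered constraints, outputs a set $E$ of edges that satisfies all the constraints and has $$|E|\;\le\; C\,(\log r+\log n)\cdot \mathrm{OPT}.$$ (If $r=0$, then $\mathrm{OPT}=0$ and the output is $E=\emptyset$.) -/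

import Mathlib

/-! ## Network construction with ordered constraints -/

namespace NetCon

/-- An ordered constraint on the vertex set `V`: an ordering `(v₁, …, vₛ)` of a subset of `V`
of size `s ≥ 2`, given as a list without repetitions. -/
structure OrderedConstraint (V : Type) where
  order : List V
  nodup : order.Nodup
  two_le : 2 ≤ order.length

/-- The ordered constraint `(v₁, …, vₛ)` is satisfied by the graph `G` if every `vᵢ` other than
`v₁` is joined by an edge of `G` to some `vⱼ` with `j < i`. -/
def OrderedConstraint.Satisfied {V : Type} (O : OrderedConstraint V) (G : SimpleGraph V) : Prop :=
  ∀ i : Fin O.order.length, 0 < (i : ℕ) →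
    ∃ j : Fin O.order.length, j < i ∧ G.Adj (O.order.get j) (O.order.get i)

/-- An instance on the vertex set `{0, …, n - 1}`: a finite collection of ordered constraints.
The number `r` of constraints is the length of the list. -/
abbrev NetInstance (n : ℕ) : Type := List (OrderedConstraint (Fin n))

/-- A solution of the instance: a graph on the vertex set satisfying all the constraints. -/
def IsSolution {n : ℕ} (I : NetInstance n) (G : SimpleGraph (Fin n)) : Prop :=
  ∀ O ∈ I, O.Satisfied G

/-- The number of edges of a graph. -/
noncomputable def numEdges {n : ℕ} (G : SimpleGraph (Fin n)) : ℕ := G.edgeSet.ncard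

/-- The minimum number of edges of a solution. -/
noncomputable def opt {n : ℕ} (I : NetInstance n) : ℕ :=
  sInf {k | ∃ G : SimpleGraph (Fin n), IsSolution I G ∧ numEdges G = k}

/-- The minimum in `opt` is over a nonempty set, and so is attained. -/
theorem exists_optimal_solution {n : ℕ} (I : NetInstance n) :
    ∃ G : SimpleGraph (Fin n), IsSolution I G ∧ numEdges G = opt I := by
  refine Nat.sInf_mem (s := {k | ∃ G : SimpleGraph (Fin n), IsSolution I G ∧ numEdges G = k})
    ⟨numEdges (⊤ : SimpleGraph (Fin n)), ⊤, ?_, rfl⟩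
  intro O _ i hi
  refine ⟨⟨0, by omega⟩, hi, ?_⟩
  rw [SimpleGraph.top_adj]
  intro h
  have h2 := (List.Nodup.get_inj_iff O.nodup).1 h
  have h3 := congrArg Fin.val h2
  simp only at h3
  omega

/-! ## Random access machines

Structured programs of a random access machine with unit-cost instructions. The machine has
registers and arrays, numbered by `ℕ` (a program names only finitely many of them), which hold
natural numbers. The arithmetic instructions are addition and truncated subtraction. There is no
multiplication, so that `t` steps lengthen the binary representation of the numbers involved by
at most `t` bits, and unit cost and bit cost are polynomially related. -/

/-- The contents of the registers, and of the arrays (first the array, then the index). -/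
structure RamState where
  reg : ℕ → ℕ
  arr : ℕ → ℕ → ℕ

/-- Write the value `c` into register `x`. -/
def RamState.setReg (s : RamState) (x c : ℕ) : RamState :=
  { s with reg := Function.update s.reg x c }

/-- Write the value `c` into cell `k` of array `a`. -/
def RamState.setArr (s : RamState) (a k c : ℕ) : RamState :=
  { s with arr := Function.update s.arr a (Function.update (s.arr a) k c) }

/-- Tests: comparison of the contents of two registers. -/
inductive RamTest where
  | lt (x y : ℕ)
  | eq (x y : ℕ)

/-- The test succeeds in the given state. -/
def RamTest.Holds : RamTest → RamState → Prop
  | .lt x y, s => s.reg x < s.reg y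
  | .eq x y, s => s.reg x = s.reg y

/-- Basic instructions. `x`, `y`, `z` are register numbers, `a` is an array number and
`c` is a constant. -/
inductive RamInstr where
  /-- do nothing -/
  | nop
  /-- `x := c` -/
  | const (x c : ℕ)
  /-- `x := y` -/
  | copy (x y : ℕ)
  /-- `x := y + z` -/
  | add (x y z : ℕ)
  /-- `x := y - z` (truncated at zero) -/
  | sub (x y z : ℕ)
  /-- `x := a[y]` -/
  | load (x a y : ℕ)
  /-- `a[y] := x` -/
  | store (a y x : ℕ)

/-- The effect of a basic instruction. -/
def RamInstr.apply : RamInstr → RamState → RamState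
  | .nop, s => s
  | .const x c, s => s.setReg x c
  | .copy x y, s => s.setReg x (s.reg y)
  | .add x y z, s => s.setReg x (s.reg y + s.reg z)
  | .sub x y z, s => s.setReg x (s.reg y - s.reg z)
  | .load x a y, s => s.setReg x (s.arr a (s.reg y))
  | .store a y x, s => s.setArr a (s.reg y) (s.reg x)

/-- Programs: basic instructions combined by sequencing, branching (if-then-else) and
while-loops. -/
inductive RamProgram where
  | instr (i : RamInstr)
  | seq (P Q : RamProgram)
  | branch (b : RamTest) (P Q : RamProgram)
  | loop (b : RamTest) (P : RamProgram)

/-- `Exec P s s' t`: started in state `s`, the program `P` halts in state `s'` after exactly `t`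
steps. Every basic instruction and every evaluation of a test is one step. -/
inductive Exec : RamProgram → RamState → RamState → ℕ → Prop
  | instr (i : RamInstr) (s : RamState) : Exec (.instr i) s (i.apply s) 1
  | seq {P Q : RamProgram} {s s' s'' : RamState} {t t' : ℕ} :
      Exec P s s' t → Exec Q s' s'' t' → Exec (.seq P Q) s s'' (t + t')
  | branch_true {b : RamTest} {P Q : RamProgram} {s s' : RamState} {t : ℕ} :
      b.Holds s → Exec P s s' t → Exec (.branch b P Q) s s' (1 + t)
  | branch_false {b : RamTest} {P Q : RamProgram} {s s' : RamState} {t : ℕ} :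
      ¬ b.Holds s → Exec Q s s' t → Exec (.branch b P Q) s s' (1 + t)
  | loop_true {b : RamTest} {P : RamProgram} {s s' s'' : RamState} {t t' : ℕ} :
      b.Holds s → Exec P s s' t → Exec (.loop b P) s' s'' t' →
        Exec (.loop b P) s s'' (1 + t + t')
  | loop_false {b : RamTest} {P : RamProgram} {s : RamState} :
      ¬ b.Holds s → Exec (.loop b P) s s 1

/-- Programs are deterministic: final state and number of steps are determined by the start. -/
theorem Exec.deterministic {P : RamProgram} {s s₁ : RamState} {t₁ : ℕ} (h₁ : Exec P s s₁ t₁) :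
    ∀ {s₂ : RamState} {t₂ : ℕ}, Exec P s s₂ t₂ → s₁ = s₂ ∧ t₁ = t₂ := by
  induction h₁ with
  | instr i s =>
    intro s₂ t₂ h₂
    cases h₂
    exact ⟨rfl, rfl⟩
  | seq _ _ ih ih' =>
    intro s₂ t₂ h₂
    cases h₂ with
    | seq g g' =>
      obtain ⟨rfl, rfl⟩ := ih g
      obtain ⟨rfl, rfl⟩ := ih' g'
      exact ⟨rfl, rfl⟩
  | branch_true hb _ ih =>
    intro s₂ t₂ h₂
    cases h₂ with
    | branch_true _ g =>
      obtain ⟨rfl, rfl⟩ := ih g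
      exact ⟨rfl, rfl⟩
    | branch_false hb' _ => exact absurd hb hb'
  | branch_false hb _ ih =>
    intro s₂ t₂ h₂
    cases h₂ with
    | branch_true hb' _ => exact absurd hb' hb
    | branch_false _ g =>
      obtain ⟨rfl, rfl⟩ := ih g
      exact ⟨rfl, rfl⟩
  | loop_true hb _ _ ih ih' =>
    intro s₂ t₂ h₂
    cases h₂ with
    | loop_true _ g g' =>
      obtain ⟨rfl, rfl⟩ := ih g
      obtain ⟨rfl, rfl⟩ := ih' g'
      exact ⟨rfl, rfl⟩
    | loop_false hb' => exact absurd hb hb'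
  | loop_false hb =>
    intro s₂ t₂ h₂
    cases h₂ with
    | loop_true hb' _ _ => exact absurd hb' hb
    | loop_false _ => exact ⟨rfl, rfl⟩

/-- The initial state on input word `w`: array `0` holds `w`, register `0` holds the length of
`w`, and everything else is zero. -/
def initState (w : List ℕ) : RamState where
  reg := fun x => if x = 0 then w.length else 0
  arr := fun a k => if a = 0 then w.getD k 0 else 0

/-- The output word of a state is `w`: register `1` holds the length of `w`, and array `1`
begins with `w`. -/
def HasOutput (s : RamState) (w : List ℕ) : Prop :=
  s.reg 1 = w.length ∧ ∀ (k : ℕ) (hk : k < w.length), s.arr 1 k = w[k]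

/-- On input word `w`, the program `P` halts after at most `T` steps with output word `w'`. -/
def ComputesWithin (P : RamProgram) (w w' : List ℕ) (T : ℕ) : Prop :=
  ∃ (s : RamState) (t : ℕ), Exec P (initState w) s t ∧ t ≤ T ∧ HasOutput s w'

/-! ## Approximation algorithms for network construction -/

/-- An instance as an input word: the number `n` of vertices, the number `r` of constraints, and
for each constraint its size followed by its vertices in order. -/
def encodeInstance {n : ℕ} (I : NetInstance n) : List ℕ :=
  n :: I.length :: I.flatMap fun O => O.order.length :: O.order.map fun v => (v : ℕ)

/-- The size of an instance: the number of vertices plus the total size of the constraints.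
All the entries of the input word are bounded by it. -/
def instanceSize {n : ℕ} (I : NetInstance n) : ℕ :=
  n + (I.map fun O => O.order.length).sum

/-- The word `w` lists the edges of `G`: it is the concatenation of pairs `u, v` of endpoints of
the edges of `G`, every edge being listed exactly once. -/
def ListsEdges {n : ℕ} (w : List ℕ) (G : SimpleGraph (Fin n)) : Prop :=
  ∃ L : List (Fin n × Fin n),
    (w = L.flatMap fun e => [(e.1 : ℕ), (e.2 : ℕ)]) ∧
    (L.map fun e => s(e.1, e.2)).Nodup ∧
    ∀ e : Sym2 (Fin n), e ∈ G.edgeSet ↔ e ∈ L.map fun e => s(e.1, e.2)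

/-- The program `P` is a polynomial-time approximation algorithm for network construction with
ordered constraints, with approximation ratio `ρ n r` on instances with `n` vertices and `r`
constraints. -/
def IsPolyTimeApproximation (P : RamProgram) (ρ : ℕ → ℕ → ℝ) : Prop :=
  ∃ p : Polynomial ℕ, ∀ (n : ℕ) (I : NetInstance n),
    ∃ (w : List ℕ) (G : SimpleGraph (Fin n)),
      ComputesWithin P (encodeInstance I) w (p.eval (instanceSize I)) ∧
      ListsEdges w G ∧ IsSolution I G ∧
      (numEdges G : ℝ) ≤ ρ n I.length * (opt I : ℝ)

end NetCon

namespace NetCon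

/-! ### Running programs -/

/-! The problem is an instance of set cover. Every vertex of a constraint other than its first one
is a requirement, represented by its position in the input word. A pair `{u, v}` meets the
requirement at a position if one of `u`, `v` stands there and the other occurs earlier in the same
constraint (`position_mem_hits`). The edges of a solution meet every requirement
(`covers_of_isSolution`), and any family of pairs meeting all that can be met is a solution
(`isSolution_graphOf`).

The greedy algorithm is analysed with the potential `L.length + E.card * harmonic (D \ S).card`, for
an arbitrary cover `E`. If all gains are at most `t`, then at most `E.card * t` requirements are
open (`Greedy.uncovered_le`). Choosing a pair of gain `t` therefore lowers the harmonic term by at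
least one (`harmonic_add_ge`), so the potential never increases (`Greedy.add`). Hence the output has
at most `harmonic D.card` times as many pairs as any cover, and `one_add_log_length_le` turns this
into the stated ratio.

Instead of searching for a maximum, the program lowers a threshold `t` from the word length to 1
and, for each `t`, passes once over all pairs, choosing those of gain at least `t`. Gains only
shrink (`gain_anti`), so one pass leaves every gain below `t`, and each chosen pair has maximal
gain. The program is verified with loop invariants that also count steps (`wp_loop`,
`wp_greedyProgram`). -/

/-- `wp P Q s`: started in `s`, the program `P` halts in a state `s'` after `t` steps such
that `Q s' t`. -/
def wp (P : RamProgram) (Q : RamState → ℕ → Prop) (s : RamState) : Prop :=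
  ∃ s' t, Exec P s s' t ∧ Q s' t

theorem wp.mono {P : RamProgram} {Q R : RamState → ℕ → Prop} {s : RamState} (h : wp P Q s)
    (hQR : ∀ s' t, Q s' t → R s' t) : wp P R s := by
  obtain ⟨s', t, he, hq⟩ := h
  exact ⟨s', t, he, hQR _ _ hq⟩

theorem wp_instr {i : RamInstr} {Q : RamState → ℕ → Prop} {s : RamState} :
    wp (.instr i) Q s ↔ Q (i.apply s) 1 := by
  constructor
  · rintro ⟨s', t, he, hq⟩
    cases he
    exact hq
  · exact fun h => ⟨_, _, .instr i s, h⟩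

theorem wp_seq {P R : RamProgram} {Q : RamState → ℕ → Prop} {s : RamState} :
    wp (.seq P R) Q s ↔ wp P (fun s' t => wp R (fun s'' t' => Q s'' (t + t')) s') s := by
  constructor
  · rintro ⟨s', t, he, hq⟩
    cases he with
    | seq h h' => exact ⟨_, _, h, _, _, h', hq⟩
  · rintro ⟨_, _, h, _, _, h', hq⟩
    exact ⟨_, _, .seq h h', hq⟩

theorem wp_branch {b : RamTest} {P R : RamProgram} {Q : RamState → ℕ → Prop} {s : RamState} :
    wp (.branch b P R) Q s ↔
      (b.Holds s → wp P (fun s' t => Q s' (1 + t)) s) ∧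
      (¬ b.Holds s → wp R (fun s' t => Q s' (1 + t)) s) := by
  constructor
  · rintro ⟨s', t, he, hq⟩
    cases he with
    | branch_true hb h => exact ⟨fun _ => ⟨_, _, h, hq⟩, fun hn => absurd hb hn⟩
    | branch_false hb h => exact ⟨fun hn => absurd hn hb, fun _ => ⟨_, _, h, hq⟩⟩
  · rintro ⟨h₁, h₂⟩
    by_cases hb : b.Holds s
    · obtain ⟨_, _, h, hq⟩ := h₁ hb
      exact ⟨_, _, .branch_true hb h, hq⟩
    · obtain ⟨_, _, h, hq⟩ := h₂ hb
      exact ⟨_, _, .branch_false hb h, hq⟩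

/-- A loop whose body is executed exactly `N` times, each time in at most `B` steps. -/
theorem wp_loop {b : RamTest} {P : RamProgram} (Inv : ℕ → RamState → Prop) (N B : ℕ)
    (hstep : ∀ k < N, ∀ s, Inv k s → b.Holds s ∧ wp P (fun s' t => Inv (k + 1) s' ∧ t ≤ B) s)
    (hend : ∀ s, Inv N s → ¬ b.Holds s) {s : RamState} (h0 : Inv 0 s) :
    wp (.loop b P) (fun s' t => Inv N s' ∧ t ≤ N * (B + 1) + 1) s := by
  -- Induction on the number `m` of iterations still to come, since a loop execution unfolds from
  -- its first iteration.
  suffices H : ∀ m k, k + m = N → ∀ s, Inv k s →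
      wp (.loop b P) (fun s' t => Inv N s' ∧ t ≤ m * (B + 1) + 1) s from
    H N 0 (Nat.zero_add N) s h0
  intro m
  induction m with
  | zero =>
    intro k hk s hs
    obtain rfl : k = N := hk
    exact ⟨s, 1, .loop_false (hend s hs), hs, by omega⟩
  | succ m ih =>
    intro k hk s hs
    obtain ⟨hb, s₁, t₁, he₁, hs₁, ht₁⟩ := hstep k (by omega) s hs
    obtain ⟨s₂, t₂, he₂, hs₂, ht₂⟩ := ih (k + 1) (by omega) s₁ hs₁
    refine ⟨s₂, _, .loop_true hb he₁ he₂, hs₂, ?_⟩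
    rw [Nat.succ_mul]
    omega

/-! ### Scanning the input word for the requirements met by an edge -/

/-- One step of the scan: the state consists of the number of entries left in the current
constraint, and of a flag telling whether `u` or `v` occurred in it. -/
def scanStep (u v : ℕ) (σ : ℕ × ℕ) (x : ℕ) : ℕ × ℕ :=
  if σ.1 = 0 then (x, 0) else (σ.1 - 1, if (x = u ∨ x = v) ∧ σ.2 = 0 then 1 else σ.2)

/-- The state of the scan at position `k` of the word `w`. -/
def scanState (w : List ℕ) (u v k : ℕ) : ℕ × ℕ :=
  ((w.take k).drop 2).foldl (scanStep u v) (0, 0)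

/-- The positions of `w` at which the second of the two vertices `e.1`, `e.2` occurs in a
constraint: these are the requirements met by the edge `e`. -/
def hits (w : List ℕ) (e : ℕ × ℕ) : Finset ℕ :=
  (Finset.range w.length).filter fun p =>
    2 ≤ p ∧ (scanState w e.1 e.2 p).1 ≠ 0 ∧ (w.getD p 0 = e.1 ∨ w.getD p 0 = e.2) ∧
      (scanState w e.1 e.2 p).2 ≠ 0

theorem scanState_two (w : List ℕ) (u v : ℕ) : scanState w u v 2 = (0, 0) := by
  simp [scanState]

theorem scanState_succ {w : List ℕ} (u v : ℕ) {k : ℕ} (hk : 2 ≤ k) (hkw : k < w.length) :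
    scanState w u v (k + 1) = scanStep u v (scanState w u v k) (w.getD k 0) := by
  have h : (w.take (k + 1)).drop 2 = (w.take k).drop 2 ++ [w.getD k 0] := by
    rw [List.take_succ_eq_append_getElem hkw, List.drop_append_of_le_length, List.getD_eq_getElem]
    simp
    omega
  rw [scanState, h, List.foldl_append]
  rfl

theorem mem_hits_iff {w : List ℕ} {u v k : ℕ} (hk : 2 ≤ k) (hkw : k < w.length) :
    k ∈ hits w (u, v) ↔ (scanState w u v k).1 ≠ 0 ∧ (w.getD k 0 = u ∨ w.getD k 0 = v) ∧
      (scanState w u v k).2 ≠ 0 := by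
  simp [hits, hk, hkw]

/-! ### The program

Registers: 0 length of the input, 1 length of the output, 2 the constant one, 3 number of
vertices, 4 threshold, 5 and 6 the current pair of vertices, 7 the constant zero, 8 position,
9 and 10 the scan state, 11 current entry, 12 gain, 13 mark of the current position.
Arrays: 0 input, 1 output, 2 marks of the requirements that are met. -/

/-- At a requirement met by the current pair: if it is unmarked, count it, and write the content
of register `m` as its mark. -/
def hitProgram (m : ℕ) : RamProgram :=
  .branch (.eq 10 7) (.instr (.copy 10 2))
    (.seq (.instr (.load 13 2 8))
      (.branch (.eq 13 7) (.seq (.instr (.add 12 12 2)) (.instr (.store 2 8 m))) (.instr .nop)))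

/-- Process one entry of the input word. -/
def scanBody (m : ℕ) : RamProgram :=
  .seq (.instr (.load 11 0 8))
    (.seq
      (.branch (.eq 9 7) (.seq (.instr (.copy 9 11)) (.instr (.const 10 0)))
        (.seq (.instr (.sub 9 9 2))
          (.branch (.eq 11 5) (hitProgram m) (.branch (.eq 11 6) (hitProgram m) (.instr .nop)))))
      (.instr (.add 8 8 2)))

/-- Scan the input word. -/
def scanProgram (m : ℕ) : RamProgram :=
  .seq (.instr (.const 8 2)) (.seq (.instr (.const 9 0)) (.seq (.instr (.const 10 0))
    (.seq (.instr (.const 12 0)) (.loop (.lt 8 0) (scanBody m)))))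

/-- Add the current pair to the output. -/
def emitProgram : RamProgram :=
  .seq (.instr (.store 1 1 5)) (.seq (.instr (.add 1 1 2))
    (.seq (.instr (.store 1 1 6)) (.instr (.add 1 1 2))))

/-- Choose the current pair if its gain reaches the threshold. -/
def tryProgram : RamProgram :=
  .seq (scanProgram 7) (.branch (.lt 12 4) (.instr .nop) (.seq (scanProgram 2) emitProgram))

/-- Try all pairs whose larger element is the current vertex. -/
def rowProgram : RamProgram :=
  .seq (.instr (.const 6 0)) (.loop (.lt 6 5) (.seq tryProgram (.instr (.add 6 6 2))))

/-- Try all pairs. -/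
def phaseProgram : RamProgram :=
  .seq (.instr (.const 5 0)) (.loop (.lt 5 3) (.seq rowProgram (.instr (.add 5 5 2))))

/-- The greedy algorithm, with descending thresholds. -/
def greedyProgram : RamProgram :=
  .seq (.instr (.const 2 1)) (.seq (.instr (.load 3 0 7)) (.seq (.instr (.copy 4 0))
    (.loop (.lt 7 4) (.seq phaseProgram (.instr (.sub 4 4 2))))))

/-! ### Correctness of the scan -/

/-- The marks after the part of the word before position `k` has been scanned. -/
def marksAt (cov : ℕ → ℕ) (T : Finset ℕ) (μ k : ℕ) (p : ℕ) : ℕ :=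
  if (p ∈ T ∧ p < k) ∧ cov p = 0 then μ else cov p

/-- The number of unmarked requirements before position `k`. -/
def gainAt (cov : ℕ → ℕ) (T : Finset ℕ) (k : ℕ) : ℕ :=
  (T.filter fun p => p < k ∧ cov p = 0).card

/-- Only an unmarked requirement changes the marks or the gain. This lemma and the next three match
the outcomes of `hitProgram`. -/
theorem marksAt_succ_of_not {cov : ℕ → ℕ} {T : Finset ℕ} {μ k : ℕ} (h : ¬ (k ∈ T ∧ cov k = 0)) :
    marksAt cov T μ (k + 1) = marksAt cov T μ k := by
  funext p
  unfold marksAt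
  congr 1
  rw [Nat.lt_succ_iff_lt_or_eq]
  grind

theorem gainAt_succ_of_not {cov : ℕ → ℕ} {T : Finset ℕ} {k : ℕ} (h : ¬ (k ∈ T ∧ cov k = 0)) :
    gainAt cov T (k + 1) = gainAt cov T k := by
  unfold gainAt
  congr 1
  ext p
  simp only [Finset.mem_filter, Nat.lt_succ_iff_lt_or_eq]
  grind

theorem marksAt_succ_of_mem {cov : ℕ → ℕ} {T : Finset ℕ} {μ k : ℕ} (h : k ∈ T) (h0 : cov k = 0) :
    marksAt cov T μ (k + 1) = Function.update (marksAt cov T μ k) k μ := by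
  funext p
  simp only [marksAt, Function.update_apply, Nat.lt_succ_iff_lt_or_eq]
  grind

theorem gainAt_succ_of_mem {cov : ℕ → ℕ} {T : Finset ℕ} {k : ℕ} (h : k ∈ T) (h0 : cov k = 0) :
    gainAt cov T (k + 1) = gainAt cov T k + 1 := by
  unfold gainAt
  rw [← Finset.card_insert_of_notMem (a := k) (by simp)]
  congr 1
  ext p
  simp only [Finset.mem_filter, Finset.mem_insert, Nat.lt_succ_iff_lt_or_eq]
  grind

/-- When the scan reads the mark of the current position, that cell still has its value from before
the scan. -/
theorem marksAt_self (cov : ℕ → ℕ) (T : Finset ℕ) (μ k : ℕ) : marksAt cov T μ k k = cov k := by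
  simp [marksAt]

/-- The state `s` of the machine during a scan that started in state `s₀`. -/
structure Scanning (w : List ℕ) (u v μ : ℕ) (s₀ : RamState) (k : ℕ) (s : RamState) : Prop where
  reg : ∀ x < 8, s.reg x = s₀.reg x
  arr : ∀ a, a ≠ 2 → s.arr a = s₀.arr a
  pos : s.reg 8 = k
  rem : s.reg 9 = (scanState w u v k).1
  seen : s.reg 10 = (scanState w u v k).2
  gain : s.reg 12 = gainAt (s₀.arr 2) (hits w (u, v)) k
  marks : s.arr 2 = marksAt (s₀.arr 2) (hits w (u, v)) μ k

theorem wp_scanBody {w : List ℕ} {u v μ m k : ℕ} {s₀ s : RamState} (hm : m < 8)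
    (hμ : s₀.reg m = μ) (h1 : s₀.reg 2 = 1) (hu : s₀.reg 5 = u)
    (hv : s₀.reg 6 = v) (hz : s₀.reg 7 = 0) (hw : s₀.arr 0 = fun k => w.getD k 0) (hk : 2 ≤ k)
    (hkw : k < w.length) (h : Scanning w u v μ s₀ k s) :
    wp (scanBody m) (fun s' t => Scanning w u v μ s₀ (k + 1) s' ∧ t ≤ 12) s := by
  obtain ⟨hreg, harr, hpos, hrem, hseen, hgain, hmarks⟩ := h
  have r2 : s.reg 2 = 1 := by rw [hreg 2 (by norm_num), h1]
  have r5 : s.reg 5 = u := by rw [hreg 5 (by norm_num), hu]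
  have r6 : s.reg 6 = v := by rw [hreg 6 (by norm_num), hv]
  have r7 : s.reg 7 = 0 := by rw [hreg 7 (by norm_num), hz]
  have rm : s.reg m = μ := by rw [hreg m hm, hμ]
  have a0 : s.arr 0 k = w.getD k 0 := by rw [harr 0 (by norm_num), hw]
  have a2 : s.arr 2 k = s₀.arr 2 k := by rw [hmarks, marksAt_self]
  have hstate := scanState_succ u v hk hkw
  have hmem := mem_hits_iff (u := u) (v := v) hk hkw
  -- The body overwrites only registers 8 to 13, so the register that holds the mark keeps its
  -- value.
  have m9 : m ≠ 9 := by omega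
  have m11 : m ≠ 11 := by omega
  have m12 : m ≠ 12 := by omega
  have m13 : m ≠ 13 := by omega
  have hkeep := @marksAt_succ_of_not (s₀.arr 2) (hits w (u, v)) μ k
  have gkeep := @gainAt_succ_of_not (s₀.arr 2) (hits w (u, v)) k
  have hadd := @marksAt_succ_of_mem (s₀.arr 2) (hits w (u, v)) μ k
  have gadd := @gainAt_succ_of_mem (s₀.arr 2) (hits w (u, v)) k
  rw [hmem] at hkeep gkeep hadd gadd
  generalize scanState w u v k = σ at *
  generalize w.getD k 0 = x at *
  clear hmem hw
  have hfin : ∀ s' : RamState, (∀ x < 8, s'.reg x = s.reg x) → (∀ a, a ≠ 2 → s'.arr a = s.arr a) →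
      s'.reg 8 = k + 1 → s'.reg 9 = (scanStep u v σ x).1 → s'.reg 10 = (scanStep u v σ x).2 →
      s'.reg 12 = gainAt (s₀.arr 2) (hits w (u, v)) (k + 1) →
      s'.arr 2 = marksAt (s₀.arr 2) (hits w (u, v)) μ (k + 1) →
      Scanning w u v μ s₀ (k + 1) s' := by
    intro s' g1 g2 g3 g4 g5 g6 g7
    exact ⟨fun x hx => (g1 x hx).trans (hreg x hx), fun a ha => (g2 a ha).trans (harr a ha), g3,
      by rw [g4, hstate], by rw [g5, hstate], g6, g7⟩
  clear hstate harr hreg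
  have hlow : ∀ y < 8, y ≠ 8 ∧ y ≠ 9 ∧ y ≠ 10 ∧ y ≠ 11 ∧ y ≠ 12 ∧ y ≠ 13 := by omega
  simp only [scanBody, hitProgram, wp_seq, wp_instr, wp_branch, RamInstr.apply, RamTest.Holds,
    RamState.setReg, RamState.setArr, Function.update_apply, if_true, if_false,
    Nat.reduceEqDiff, r2, r5, r6, r7, rm, a0, a2, hpos, hrem, hseen, hgain, m9, m11, m12, m13]
  -- The eight control paths: a size entry; for each of `u` and `v`, a first occurrence, an unmarked
  -- requirement or a marked one; and an unrelated vertex.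
  refine ⟨fun c1 => ?_, fun c1 => ⟨fun c2 => ⟨fun c3 => ?_, fun c3 => ⟨fun c4 => ?_, fun c4 => ?_⟩⟩,
    fun c2 => ⟨fun c5 => ⟨fun c3 => ?_, fun c3 => ⟨fun c4 => ?_, fun c4 => ?_⟩⟩, fun c5 => ?_⟩⟩⟩
  all_goals
    refine ⟨hfin _ (fun y hy => ?_) (fun a ha => ?_) ?_ ?_ ?_ ?_ ?_, by norm_num⟩
    · obtain ⟨y8, y9, y10, y11, y12, y13⟩ := hlow y hy
      simp only [Function.update_apply, y8, y9, y10, y11, y12, y13, if_false]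
    · simp [ha]
    · simp
    · simp [scanStep, c1]
    · simp [*, scanStep]
    · simp [*]
    · simp [*]

end NetCon

namespace NetCon

/-! ### The greedy algorithm for set cover -/

/-- Each of the `g` additional reciprocals is at least `1 / M`. -/
theorem harmonic_add_ge (m M : ℕ) :
    ∀ g, m + g ≤ M → harmonic m + (g : ℚ) / M ≤ harmonic (m + g) := by
  intro g
  induction g with
  | zero => simp
  | succ g ih =>
    intro h
    have h1 := ih (by omega)
    have h2 : (1 : ℚ) / M ≤ ((m + g + 1 : ℕ) : ℚ)⁻¹ := by
      rw [one_div]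
      exact inv_anti₀ (by positivity) (by exact_mod_cast h)
    rw [← add_assoc, harmonic_succ]
    push_cast at h2 ⊢
    rw [add_div]
    linarith

/-- The unordered pairs of vertices, as pairs with decreasing entries. -/
def IsPair (n : ℕ) (e : ℕ × ℕ) : Prop := e.2 < e.1 ∧ e.1 < n

/-- The family `E` of pairs covers everything that can be covered. -/
def Covers (n : ℕ) (H : ℕ × ℕ → Finset ℕ) (E : Finset (ℕ × ℕ)) : Prop :=
  (∀ e ∈ E, IsPair n e) ∧ ∀ e, IsPair n e → ∀ p ∈ H e, ∃ f ∈ E, p ∈ H f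

/-- The greedy invariant: `L` are the chosen pairs, `S` is the covered set, every pair has gain
at most `t`, and the number of chosen pairs is bounded in terms of any cover. -/
structure Greedy (n : ℕ) (H : ℕ × ℕ → Finset ℕ) (D : Finset ℕ) (t : ℕ) (S : Finset ℕ)
    (L : List (ℕ × ℕ)) : Prop where
  subset : S ⊆ D
  mem_iff : ∀ p, p ∈ S ↔ ∃ e ∈ L, p ∈ H e
  isPair : ∀ e ∈ L, IsPair n e
  nodup : L.Nodup
  gain_le : ∀ e, IsPair n e → (H e \ S).card ≤ t
  length_le : ∀ E, Covers n H E →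
    (L.length : ℚ) + E.card * harmonic (D \ S).card ≤ E.card * harmonic D.card

theorem Greedy.init {n : ℕ} {H : ℕ × ℕ → Finset ℕ} {D : Finset ℕ} {t : ℕ}
    (ht : ∀ e, (H e).card ≤ t) : Greedy n H D t ∅ [] where
  subset := Finset.empty_subset _
  mem_iff := by simp
  isPair := by simp
  nodup := List.nodup_nil
  gain_le e _ := by simpa using ht e
  length_le E _ := by simp

variable {n : ℕ} {H : ℕ × ℕ → Finset ℕ} {D : Finset ℕ} {t : ℕ} {S : Finset ℕ} {L : List (ℕ × ℕ)}

/-- This monotonicity is why one pass per threshold suffices. -/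
theorem gain_anti (e f : ℕ × ℕ) : (H e \ (S ∪ H f)).card ≤ (H e \ S).card :=
  Finset.card_le_card (Finset.sdiff_subset_sdiff subset_rfl Finset.subset_union_left)

/-- If the pairs of a cover have gain at most `t`, then at most `t` times its size is still
uncovered. -/
theorem Greedy.uncovered_le (h : Greedy n H D t S L) (hD : ∀ p ∈ D, ∃ e, IsPair n e ∧ p ∈ H e)
    {E : Finset (ℕ × ℕ)} (hE : Covers n H E) : (D \ S).card ≤ E.card * t := by
  have hsub : D \ S ⊆ E.biUnion fun e => H e \ S := by
    intro p hp
    rw [Finset.mem_sdiff] at hp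
    obtain ⟨e, he, hpe⟩ := hD p hp.1
    obtain ⟨f, hf, hpf⟩ := hE.2 e he p hpe
    exact Finset.mem_biUnion.2 ⟨f, hf, Finset.mem_sdiff.2 ⟨hpf, hp.2⟩⟩
  refine (Finset.card_le_card hsub).trans (Finset.card_biUnion_le_card_mul _ _ _ ?_)
  exact fun e he => h.gain_le e (hE.1 e he)

theorem Greedy.add (h : Greedy n H D t S L) (hD : ∀ p, p ∈ D ↔ ∃ e, IsPair n e ∧ p ∈ H e)
    (ht : 0 < t) {e : ℕ × ℕ} (he : IsPair n e) (hgain : t ≤ (H e \ S).card) :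
    Greedy n H D t (S ∪ H e) (L ++ [e]) where
  subset := Finset.union_subset h.subset fun p hp => (hD p).2 ⟨e, he, hp⟩
  mem_iff p := by
    rw [Finset.mem_union, h.mem_iff]
    simp [or_and_right, exists_or]
  isPair f hf := by
    rcases List.mem_append.1 hf with hf | hf
    · exact h.isPair f hf
    · rwa [List.mem_singleton.1 hf]
  nodup := by
    refine h.nodup.append (List.nodup_singleton e) ?_
    rw [List.disjoint_singleton]
    -- A pair chosen before has gain zero, which contradicts `0 < t`.
    intro heL
    have hsub : H e ⊆ S := fun p hp => (h.mem_iff p).2 ⟨e, heL, hp⟩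
    rw [Finset.sdiff_eq_empty_iff_subset.2 hsub, Finset.card_empty] at hgain
    omega
  gain_le f hf := (gain_anti f e).trans (h.gain_le f hf)
  length_le E hE := by
    have h1 := h.length_le E hE
    have h2 := h.uncovered_le (fun p hp => (hD p).1 hp) hE
    -- The threshold is also an upper bound for all gains, so the chosen pair is a greedy choice.
    have heq : (H e \ S).card = t := le_antisymm (h.gain_le e he) hgain
    have hsplit : (D \ (S ∪ H e)).card + t = (D \ S).card := by
      rw [← heq, ← Finset.card_union_of_disjoint]
      · congr 1
        ext p
        simp only [Finset.mem_union, Finset.mem_sdiff]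
        have : p ∈ H e → p ∈ D := fun hp => (hD p).2 ⟨e, he, hp⟩
        tauto
      · rw [Finset.disjoint_left]
        simp only [Finset.mem_union, Finset.mem_sdiff]
        tauto
    have hpos : 0 < (D \ S).card := by omega
    have h3 := harmonic_add_ge (D \ (S ∪ H e)).card (D \ S).card t hsplit.le
    rw [hsplit] at h3
    -- The decrease of the harmonic term, multiplied by the size of the cover, pays for the new
    -- pair.
    have h4 : (1 : ℚ) ≤ E.card * (t / (D \ S).card) := by
      rw [← mul_div_assoc, one_le_div (by exact_mod_cast hpos)]
      exact_mod_cast h2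
    have h5 := mul_le_mul_of_nonneg_left h3 (Nat.cast_nonneg (α := ℚ) E.card)
    rw [List.length_append, List.length_singleton]
    push_cast
    linarith

theorem Greedy.lower (h : Greedy n H D t S L)
    (ht : ∀ e, IsPair n e → (H e \ S).card < t) : Greedy n H D (t - 1) S L :=
  { h with gain_le := fun e he => Nat.le_sub_one_of_lt (ht e he) }

/-- When no pair has positive gain, the chosen pairs form a cover. -/
theorem Greedy.covered (h : Greedy n H D 0 S L) {e : ℕ × ℕ} (he : IsPair n e) {p : ℕ}
    (hp : p ∈ H e) : ∃ f ∈ L, p ∈ H f := by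
  rw [← h.mem_iff]
  have h0 := Nat.le_zero.1 (h.gain_le e he)
  rw [Finset.card_eq_zero, Finset.sdiff_eq_empty_iff_subset] at h0
  exact h0 hp

end NetCon

namespace NetCon

/-! ### Running the greedy program -/

theorem gainAt_length {w : List ℕ} (S : Finset ℕ) (e : ℕ × ℕ) :
    gainAt (fun p => if p ∈ S then 1 else 0) (hits w e) w.length = (hits w e \ S).card := by
  unfold gainAt
  congr 1
  ext p
  simp only [hits, Finset.mem_filter, Finset.mem_sdiff, Finset.mem_range]
  grind

/-- Writing 0 over unmarked cells changes nothing, so a scan with mark 0 is a dry run that only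
computes the gain. -/
theorem marksAt_zero (S T : Finset ℕ) (k : ℕ) :
    marksAt (fun p => if p ∈ S then 1 else 0) T 0 k = fun p => if p ∈ S then 1 else 0 := by
  funext p
  simp only [marksAt]
  grind

theorem marksAt_one {w : List ℕ} (S : Finset ℕ) (e : ℕ × ℕ) :
    marksAt (fun p => if p ∈ S then 1 else 0) (hits w e) 1 w.length =
      fun p => if p ∈ S ∪ hits w e then 1 else 0 := by
  funext p
  have : p ∈ hits w e → p < w.length := fun h =>
    Finset.mem_range.1 (Finset.mem_filter.1 h).1
  simp only [marksAt, Finset.mem_union]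
  grind

theorem wp_scanProgram {w : List ℕ} {u v μ m : ℕ} {s : RamState} (hm : m < 8)
    (hμ : s.reg m = μ) (h1 : s.reg 2 = 1) (hu : s.reg 5 = u) (hv : s.reg 6 = v)
    (hz : s.reg 7 = 0) (hw : s.arr 0 = fun k => w.getD k 0) (hlen : s.reg 0 = w.length)
    (h2 : 2 ≤ w.length) :
    wp (scanProgram m)
      (fun s' t => Scanning w u v μ s w.length s' ∧ t ≤ 13 * w.length) s := by
  simp only [scanProgram, wp_seq, wp_instr, RamInstr.apply, RamState.setReg]
  -- The scan starts at position 2, behind the entries `n` and `r`.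
  refine (wp_loop (fun k => Scanning w u v μ s (2 + k)) (w.length - 2) 12 ?_ ?_ ?_).mono ?_
  · intro k hk s' hs'
    refine ⟨?_, wp_scanBody hm hμ h1 hu hv hz hw (show 2 ≤ 2 + k by omega)
      (show 2 + k < w.length by omega) hs'⟩
    simp only [RamTest.Holds, hs'.pos, hs'.reg 0 (by norm_num), hlen]
    omega
  · intro s' hs'
    simp only [RamTest.Holds, hs'.pos, hs'.reg 0 (by norm_num), hlen]
    omega
  · refine ⟨fun x hx => ?_, fun a _ => rfl, by simp, by simp [scanState_two],
      by simp [scanState_two], ?_, ?_⟩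
    · have x8 : x ≠ 8 := by omega
      have x9 : x ≠ 9 := by omega
      have x10 : x ≠ 10 := by omega
      have x12 : x ≠ 12 := by omega
      simp [x8, x9, x10, x12]
    · simp only [Function.update_self, gainAt]
      symm
      rw [Finset.card_eq_zero, Finset.filter_eq_empty_iff]
      intro p hp
      have := (Finset.mem_filter.1 hp).2.1
      omega
    · funext p
      simp only [marksAt]
      rw [if_neg]
      rintro ⟨⟨hp, h⟩, -⟩
      have := (Finset.mem_filter.1 hp).2.1
      omega
  · rintro s' t ⟨hs', ht⟩
    rw [show 2 + (w.length - 2) = w.length by omega] at hs'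
    exact ⟨hs', by omega⟩

/-! ### Machine configurations and the test of a single pair -/

/-- The word that lists the pairs of `L`. -/
def pairWord (L : List (ℕ × ℕ)) : List ℕ := L.flatMap fun e => [e.1, e.2]

theorem pairWord_append (L : List (ℕ × ℕ)) (e : ℕ × ℕ) :
    pairWord (L ++ [e]) = pairWord L ++ [e.1, e.2] := by
  simp [pairWord]

/-- The state of the machine when the pairs of `L` are chosen and the requirements in `S` are
met, the threshold is `t` and the current pair is `(u, v)`. -/
structure Config (w : List ℕ) (n t u v : ℕ) (S : Finset ℕ) (L : List (ℕ × ℕ)) (s : RamState) :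
    Prop where
  len : s.reg 0 = w.length
  output : HasOutput s (pairWord L)
  one : s.reg 2 = 1
  vertices : s.reg 3 = n
  threshold : s.reg 4 = t
  fst : s.reg 5 = u
  snd : s.reg 6 = v
  zero : s.reg 7 = 0
  input : s.arr 0 = fun k => w.getD k 0
  marks : s.arr 2 = fun p => if p ∈ S then 1 else 0

variable {w : List ℕ} {n t u v : ℕ} {S : Finset ℕ} {L : List (ℕ × ℕ)} {s : RamState}

theorem Config.of_scanning {s' : RamState} {μ k : ℕ} (h : Config w n t u v S L s)
    (hs : Scanning w u v μ s k s') {S' : Finset ℕ}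
    (hS : marksAt (fun p => if p ∈ S then 1 else 0) (hits w (u, v)) μ k =
      fun p => if p ∈ S' then 1 else 0) :
    Config w n t u v S' L s' where
  len := by rw [hs.reg 0 (by norm_num), h.len]
  output := by
    refine ⟨by rw [hs.reg 1 (by norm_num), h.output.1], fun k hk => ?_⟩
    rw [hs.arr 1 (by norm_num), h.output.2]
  one := by rw [hs.reg 2 (by norm_num), h.one]
  vertices := by rw [hs.reg 3 (by norm_num), h.vertices]
  threshold := by rw [hs.reg 4 (by norm_num), h.threshold]
  fst := by rw [hs.reg 5 (by norm_num), h.fst]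
  snd := by rw [hs.reg 6 (by norm_num), h.snd]
  zero := by rw [hs.reg 7 (by norm_num), h.zero]
  input := by rw [hs.arr 0 (by norm_num), h.input]
  marks := by rw [hs.marks, h.marks, hS]

theorem HasOutput.push {s s' : RamState} {l : List ℕ} (h : HasOutput s l) {a b : ℕ}
    (hreg : s'.reg 1 = l.length + 2)
    (harr : s'.arr 1 =
      Function.update (Function.update (s.arr 1) l.length a) (l.length + 1) b) :
    HasOutput s' (l ++ [a, b]) := by
  refine ⟨by simp [hreg], fun k hk => ?_⟩
  rw [harr]
  rcases lt_trichotomy k l.length with h1 | rfl | h1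
  · rw [List.getElem_append_left h1, ← h.2 k h1, Function.update_of_ne (by omega),
      Function.update_of_ne (by omega)]
  · simp
  · obtain rfl : k = l.length + 1 := by
      simp at hk
      omega
    simp

theorem wp_emitProgram (h : Config w n t u v S L s) :
    wp emitProgram (fun s' τ => Config w n t u v S (L ++ [(u, v)]) s' ∧ τ ≤ 4) s := by
  simp only [emitProgram, wp_seq, wp_instr, RamInstr.apply, RamState.setReg, RamState.setArr]
  refine ⟨?_, by norm_num⟩
  constructor
  · simp [h.len]
  · rw [pairWord_append]
    refine h.output.push ?_ ?_
    · simp [h.output.1, h.one]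
    · simp [h.output.1, h.one, h.fst, h.snd]
  · simp [h.one]
  · simp [h.vertices]
  · simp [h.threshold]
  · simp [h.fst]
  · simp [h.snd]
  · simp [h.zero]
  · simp [h.input]
  · simp [h.marks]

/-- The first scan writes register 7, which is zero, and measures the gain; the second writes
register 2, which is one, and records the choice. -/
theorem wp_tryProgram (hlen : 2 ≤ w.length) (h : Config w n t u v S L s) :
    wp tryProgram (fun s' τ => (∃ S' L', Config w n t u v S' L' s' ∧
      ((t ≤ (hits w (u, v) \ S).card ∧ S' = S ∪ hits w (u, v) ∧ L' = L ++ [(u, v)]) ∨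
        ((hits w (u, v) \ S).card < t ∧ S' = S ∧ L' = L))) ∧ τ ≤ 26 * w.length + 5) s := by
  rw [tryProgram, wp_seq]
  refine (wp_scanProgram (m := 7) (by norm_num) h.zero h.one h.fst h.snd h.zero h.input h.len
    hlen).mono ?_
  rintro s₁ t₁ ⟨hs₁, ht₁⟩
  have h₁ : Config w n t u v S L s₁ := h.of_scanning hs₁ (marksAt_zero _ _ _)
  have hg : s₁.reg 12 = (hits w (u, v) \ S).card := by
    rw [hs₁.gain, h.marks, gainAt_length]
  rw [wp_branch]
  simp only [RamTest.Holds, hg, h₁.threshold, wp_instr, wp_seq, RamInstr.apply, not_lt]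
  refine ⟨fun hlt => ⟨⟨S, L, h₁, Or.inr ⟨hlt, rfl, rfl⟩⟩, by omega⟩, fun hle => ?_⟩
  refine (wp_scanProgram (m := 2) (by norm_num) h₁.one h₁.one h₁.fst h₁.snd h₁.zero h₁.input
    h₁.len hlen).mono ?_
  rintro s₂ t₂ ⟨hs₂, ht₂⟩
  have h₂ : Config w n t u v (S ∪ hits w (u, v)) L s₂ := h₁.of_scanning hs₂ (marksAt_one _ _)
  refine (wp_emitProgram h₂).mono ?_
  rintro s₃ t₃ ⟨h₃, ht₃⟩
  exact ⟨⟨_, _, h₃, Or.inl ⟨hle, rfl, rfl⟩⟩, by omega⟩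

/-! ### The loops over pairs and thresholds -/

theorem Config.set_threshold (h : Config w n t u v S L s) (c : ℕ) :
    Config w n c u v S L (s.setReg 4 c) := by
  obtain ⟨h0, ⟨h1, h1'⟩, h2, h3, h4, h5, h6, h7, h8, h9⟩ := h
  constructor <;> simp_all [RamState.setReg, HasOutput]

theorem Config.set_fst (h : Config w n t u v S L s) (c : ℕ) :
    Config w n t c v S L (s.setReg 5 c) := by
  obtain ⟨h0, ⟨h1, h1'⟩, h2, h3, h4, h5, h6, h7, h8, h9⟩ := h
  constructor <;> simp_all [RamState.setReg, HasOutput]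

theorem Config.set_snd (h : Config w n t u v S L s) (c : ℕ) :
    Config w n t u c S L (s.setReg 6 c) := by
  obtain ⟨h0, ⟨h1, h1'⟩, h2, h3, h4, h5, h6, h7, h8, h9⟩ := h
  constructor <;> simp_all [RamState.setReg, HasOutput]

/-- The situation within a phase: the pairs with property `Q` have already been tried. -/
def Tried (w : List ℕ) (n t u v : ℕ) (D : Finset ℕ) (Q : ℕ × ℕ → Prop) (s : RamState) : Prop :=
  ∃ S L, Config w n t u v S L s ∧ Greedy n (hits w) D t S L ∧
    ∀ e, IsPair n e → Q e → (hits w e \ S).card < t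

variable {D : Finset ℕ}

/-- Pairs tried before stay below the threshold because gains shrink. The current pair is below it
because it failed the test or, if it was chosen, because its gain is now zero. -/
theorem wp_tryProgram_tried (hlen : 2 ≤ w.length)
    (hD : ∀ p, p ∈ D ↔ ∃ e, IsPair n e ∧ p ∈ hits w e) (ht : 0 < t) (hvu : v < u) (hun : u < n)
    {Q : ℕ × ℕ → Prop} (h : Tried w n t u v D Q s) :
    wp tryProgram (fun s' τ => Tried w n t u v D (fun e => Q e ∨ e = (u, v)) s' ∧
      τ ≤ 26 * w.length + 5) s := by
  obtain ⟨S, L, hc, hg, hQ⟩ := h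
  refine (wp_tryProgram hlen hc).mono ?_
  rintro s' τ ⟨⟨S', L', hc', ⟨hle, rfl, rfl⟩ | ⟨hlt, rfl, rfl⟩⟩, hτ⟩
  · refine ⟨⟨_, _, hc', hg.add hD ht ⟨hvu, hun⟩ hle, ?_⟩, hτ⟩
    rintro e he (hq | rfl)
    · exact (gain_anti _ _).trans_lt (hQ e he hq)
    · rw [Finset.sdiff_eq_empty_iff_subset.2 Finset.subset_union_right]
      exact ht
  · refine ⟨⟨_, _, hc', hg, ?_⟩, hτ⟩
    rintro e he (hq | rfl)
    · exact hQ e he hq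
    · exact hlt

theorem Tried.mono {Q R : ℕ × ℕ → Prop} (h : Tried w n t u v D Q s)
    (hRQ : ∀ e, IsPair n e → R e → Q e) : Tried w n t u v D R s := by
  obtain ⟨S, L, hc, hg, hQ⟩ := h
  exact ⟨S, L, hc, hg, fun e he hr => hQ e he (hRQ e he hr)⟩

theorem wp_rowProgram (hlen : 2 ≤ w.length)
    (hD : ∀ p, p ∈ D ↔ ∃ e, IsPair n e ∧ p ∈ hits w e) (ht : 0 < t) (hun : u < n)
    (h : ∃ v, Tried w n t u v D (fun e => e.1 < u) s) :
    wp rowProgram (fun s' τ => (∃ v, Tried w n t u v D (fun e => e.1 < u + 1) s') ∧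
      τ ≤ n * (26 * w.length + 7) + 2) s := by
  obtain ⟨v₀, S, L, hc, hg, hQ⟩ := h
  simp only [rowProgram, wp_seq, wp_instr, RamInstr.apply]
  refine (wp_loop (fun k => Tried w n t u k D fun e => e.1 < u ∨ e.1 = u ∧ e.2 < k) u
    (26 * w.length + 6) ?_ ?_ ?_).mono ?_
  · intro k hk s₁ hs₁
    refine ⟨?_, ?_⟩
    · obtain ⟨S, L, hc, -⟩ := hs₁
      simpa [RamTest.Holds, hc.fst, hc.snd] using hk
    · simp only [wp_seq, wp_instr, RamInstr.apply]
      refine (wp_tryProgram_tried hlen hD ht hk hun hs₁).mono ?_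
      rintro s₂ τ ⟨⟨S, L, hc, hg, hQ⟩, hτ⟩
      refine ⟨⟨S, L, ?_, hg, ?_⟩, by omega⟩
      · rw [hc.snd, hc.one]
        exact hc.set_snd _
      · rintro ⟨a, b⟩ he hab
        refine hQ _ he ?_
        simp only [Prod.mk.injEq] at hab ⊢
        omega
  · rintro s₁ ⟨S, L, hc, -⟩
    simp [RamTest.Holds, hc.fst, hc.snd]
  · refine ⟨S, L, hc.set_snd 0, hg, fun e he h => hQ e he ?_⟩
    simpa using h
  · rintro s₁ τ ⟨hs₁, hτ⟩
    refine ⟨⟨u, hs₁.mono ?_⟩, ?_⟩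
    -- A pair in row `u` has its second entry below `u`, so the whole row has been tried.
    · rintro ⟨a, b⟩ ⟨he, -⟩ hab
      simp only at he hab ⊢
      omega
    · have := Nat.mul_le_mul_right (26 * w.length + 6 + 1) hun.le
      linarith

theorem wp_phaseProgram (hlen : 2 ≤ w.length)
    (hD : ∀ p, p ∈ D ↔ ∃ e, IsPair n e ∧ p ∈ hits w e) (ht : 0 < t)
    (h : ∃ u v S L, Config w n t u v S L s ∧ Greedy n (hits w) D t S L) :
    wp phaseProgram (fun s' τ =>
      (∃ u v S L, Config w n t u v S L s' ∧ Greedy n (hits w) D (t - 1) S L) ∧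
      τ ≤ n * (n * (26 * w.length + 7) + 4) + 2) s := by
  obtain ⟨u₀, v₀, S, L, hc, hg⟩ := h
  simp only [phaseProgram, wp_seq, wp_instr, RamInstr.apply]
  refine (wp_loop (fun k s => ∃ v, Tried w n t k v D (fun e => e.1 < k) s) n
    (n * (26 * w.length + 7) + 3) ?_ ?_ ?_).mono ?_
  · intro k hk s₁ hs₁
    refine ⟨?_, ?_⟩
    · obtain ⟨v, S, L, hc, -⟩ := hs₁
      simpa [RamTest.Holds, hc.fst, hc.vertices] using hk
    · simp only [wp_seq, wp_instr, RamInstr.apply]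
      refine (wp_rowProgram hlen hD ht hk hs₁).mono ?_
      rintro s₂ τ ⟨⟨v, S, L, hc, hg, hQ⟩, hτ⟩
      refine ⟨⟨v, S, L, ?_, hg, hQ⟩, by omega⟩
      rw [hc.fst, hc.one]
      exact hc.set_fst _
  · rintro s₁ ⟨v, S, L, hc, -⟩
    simp [RamTest.Holds, hc.fst, hc.vertices]
  · exact ⟨v₀, S, L, hc.set_fst 0, hg, fun e he h => absurd h (Nat.not_lt_zero _)⟩
  · rintro s₁ τ ⟨⟨v, S, L, hc, hg, hQ⟩, hτ⟩
    exact ⟨⟨n, v, S, L, hc, hg.lower fun e he => hQ e he he.2⟩, by linarith⟩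

theorem wp_greedyProgram (hlen : 2 ≤ w.length) (hn : w.getD 0 0 = n)
    (hD : ∀ p, p ∈ D ↔ ∃ e, IsPair n e ∧ p ∈ hits w e) :
    wp greedyProgram (fun s' τ => (∃ S L, HasOutput s' (pairWord L) ∧
        Greedy n (hits w) D 0 S L) ∧
      τ ≤ w.length * (n * (n * (26 * w.length + 7) + 4) + 4) + 4) (initState w) := by
  simp only [greedyProgram, wp_seq, wp_instr, RamInstr.apply]
  -- The word length is a safe initial threshold, because a pair meets at most one requirement per
  -- position.
  refine (wp_loop (fun k s => ∃ u v S L, Config w n (w.length - k) u v S L s ∧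
    Greedy n (hits w) D (w.length - k) S L) w.length
    (n * (n * (26 * w.length + 7) + 4) + 3) ?_ ?_ ?_).mono ?_
  · intro k hk s₁ hs₁
    refine ⟨?_, ?_⟩
    · obtain ⟨u, v, S, L, hc, -⟩ := hs₁
      simp only [RamTest.Holds, hc.zero, hc.threshold]
      omega
    · simp only [wp_seq, wp_instr, RamInstr.apply]
      refine (wp_phaseProgram hlen hD (by omega) hs₁).mono ?_
      rintro s₂ τ ⟨⟨u, v, S, L, hc, hg⟩, hτ⟩
      refine ⟨⟨u, v, S, L, ?_, ?_⟩, by omega⟩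
      · rw [hc.threshold, hc.one]
        exact hc.set_threshold _
      · exact hg
  · rintro s₁ ⟨u, v, S, L, hc, -⟩
    simp [RamTest.Holds, hc.zero, hc.threshold]
  · refine ⟨0, 0, ∅, [], ?_, Greedy.init fun e => ?_⟩
    · constructor <;> simp [RamState.setReg, initState, HasOutput, pairWord, ← hn]
    · refine (Finset.card_le_card (Finset.filter_subset _ _)).trans ?_
      simp
  · rintro s₁ τ ⟨⟨u, v, S, L, hc, hg⟩, hτ⟩
    rw [Nat.sub_self] at hg
    exact ⟨⟨S, L, hc.output, hg⟩, by linarith⟩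

end NetCon

namespace NetCon

/-! ### Scanning an encoded instance -/

/-- Once nonzero, the flag stays nonzero until the next size entry. The surplus `m` allows the scan
to stop in the middle of a constraint. -/
theorem foldl_scanStep (u v m : ℕ) (l : List ℕ) : ∀ s : ℕ, ∃ s' : ℕ,
    l.foldl (scanStep u v) (l.length + m, s) = (m, s') ∧ (s' ≠ 0 ↔ s ≠ 0 ∨ u ∈ l ∨ v ∈ l) := by
  induction l with
  | nil => exact fun s => ⟨s, by simp⟩
  | cons x l ih =>
    intro s
    obtain ⟨s', h1, h2⟩ := ih (if (x = u ∨ x = v) ∧ s = 0 then 1 else s)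
    refine ⟨s', ?_, ?_⟩
    · rw [List.foldl_cons, ← h1, scanStep, if_neg (by simp)]
      congr 2
      simp only [List.length_cons]
      omega
    · rw [h2]
      simp only [List.mem_cons]
      split <;> grind

variable {n : ℕ}

/-- The encoding of a constraint. -/
def encodeConstraint (O : OrderedConstraint (Fin n)) : List ℕ :=
  O.order.length :: O.order.map Fin.val

/-- The encoding of a list of constraints. -/
def encodeConstraints (I : NetInstance n) : List ℕ := I.flatMap encodeConstraint

theorem encodeConstraints_append (I J : NetInstance n) :
    encodeConstraints (I ++ J) = encodeConstraints I ++ encodeConstraints J := by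
  simp [encodeConstraints]

theorem encodeConstraints_cons (O : OrderedConstraint (Fin n)) (I : NetInstance n) :
    encodeConstraints (O :: I) = encodeConstraint O ++ encodeConstraints I := by
  simp [encodeConstraints]

theorem encodeInstance_eq (I : NetInstance n) :
    encodeInstance I = n :: I.length :: encodeConstraints I := by
  have h : encodeConstraint (n := n) =
      fun O => O.order.length :: O.order.flatMap fun a : Fin n => [a.val] := by
    funext O
    rw [encodeConstraint, List.map_eq_flatMap]
  simp [encodeInstance, encodeConstraints, h]

/-- The counter returns to zero after each complete constraint, so the next entry is read as a size.
The final flag is irrelevant, since a size entry resets it. -/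
theorem foldl_encodeConstraints (u v : ℕ) (I : NetInstance n) : ∀ s : ℕ, ∃ s' : ℕ,
    (encodeConstraints I).foldl (scanStep u v) (0, s) = (0, s') := by
  induction I with
  | nil => exact fun s => ⟨s, rfl⟩
  | cons O I ih =>
    intro s
    obtain ⟨s₁, h₁, -⟩ := foldl_scanStep u v 0 (O.order.map Fin.val) 0
    obtain ⟨s₂, h₂⟩ := ih s₁
    refine ⟨s₂, ?_⟩
    rw [encodeConstraints_cons, List.foldl_append, encodeConstraint, List.foldl_cons, ← h₂, ← h₁]
    simp [scanStep]

/-- The position in the input word of the `i`-th vertex of a constraint which is preceded by the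
constraints in `I`. -/
def position (I : NetInstance n) (i : ℕ) : ℕ := 2 + ((encodeConstraints I).length + (1 + i))

variable {I I₁ I₂ : NetInstance n} {O : OrderedConstraint (Fin n)}

theorem scanState_start (hI : I = I₁ ++ O :: I₂) (u v : ℕ) :
    (scanState (encodeInstance I) u v (2 + (encodeConstraints I₁).length)).1 = 0 := by
  obtain ⟨s, hs⟩ := foldl_encodeConstraints u v I₁ 0
  have h : ((encodeInstance I).take (2 + (encodeConstraints I₁).length)).drop 2 =
      encodeConstraints I₁ := by
    rw [← List.take_drop, encodeInstance_eq, hI, encodeConstraints_append]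
    simp
  rw [scanState, h, hs]

theorem scanState_position (hI : I = I₁ ++ O :: I₂) (u v : ℕ) {i : ℕ} (hi : i < O.order.length) :
    (scanState (encodeInstance I) u v (position I₁ i)).1 ≠ 0 ∧
    ((scanState (encodeInstance I) u v (position I₁ i)).2 ≠ 0 ↔
      u ∈ (O.order.map Fin.val).take i ∨ v ∈ (O.order.map Fin.val).take i) := by
  obtain ⟨s, hs⟩ := foldl_encodeConstraints u v I₁ 0
  have h : ((encodeInstance I).take (position I₁ i)).drop 2 =
      encodeConstraints I₁ ++ O.order.length :: (O.order.map Fin.val).take i := by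
    rw [position, ← List.take_drop, encodeInstance_eq, hI, encodeConstraints_append,
      encodeConstraints_cons, encodeConstraint]
    simp only [List.drop_succ_cons, List.drop_zero, List.take_length_add_append,
      List.cons_append, Nat.add_comm 1 i, List.take_succ_cons]
    rw [List.take_append_of_le_length (by simpa using hi.le)]
  obtain ⟨s', h1, h2⟩ := foldl_scanStep u v (O.order.length - i)
    ((O.order.map Fin.val).take i) 0
  have hlen : ((O.order.map Fin.val).take i).length + (O.order.length - i) =
      O.order.length := by
    simp
    omega
  have h3 : scanState (encodeInstance I) u v (position I₁ i) = (O.order.length - i, s') := by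
    rw [scanState, h, List.foldl_append, hs, List.foldl_cons, ← h1, hlen]
    rfl
  rw [h3]
  refine ⟨by simp only; omega, by simpa using h2⟩

theorem getElem?_position (hI : I = I₁ ++ O :: I₂) {i : ℕ} (hi : i < O.order.length) :
    (encodeInstance I)[position I₁ i]? = some (O.order[i] : ℕ) := by
  rw [encodeInstance_eq, hI, encodeConstraints_append, encodeConstraints_cons, encodeConstraint,
    position, Nat.add_comm 2, Nat.add_comm 1]
  rw [List.getElem?_cons_succ, List.getElem?_cons_succ, List.getElem?_append_right (by omega),
    Nat.add_sub_cancel_left, List.getElem?_append_left (by simpa using hi),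
    List.getElem?_cons_succ, List.getElem?_map, List.getElem?_eq_getElem hi]
  rfl

/-- A pair meets the requirement of a vertex in a constraint exactly if it joins that vertex to an
earlier one. -/
theorem position_mem_hits (hI : I = I₁ ++ O :: I₂) {i : ℕ} (hi : i < O.order.length) {u v : ℕ}
    (huv : u ≠ v) : position I₁ i ∈ hits (encodeInstance I) (u, v) ↔
      ∃ j, ∃ hj : j < i, s((O.order[j] : ℕ), (O.order[i] : ℕ)) = s(u, v) := by
  have hget := getElem?_position hI hi
  have hlt : position I₁ i < (encodeInstance I).length := by
    by_contra hge
    rw [List.getElem?_eq_none (by omega)] at hget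
    simp at hget
  obtain ⟨h1, h2⟩ := scanState_position hI u v hi
  rw [mem_hits_iff (by unfold position; omega) hlt, h2, List.getD_eq_getElem?_getD, hget,
    Option.getD_some]
  have hmem : ∀ x : ℕ, x ∈ (O.order.map Fin.val).take i ↔
      ∃ j, ∃ hj : j < i, (O.order[j] : ℕ) = x := by
    intro x
    rw [List.mem_take_iff_getElem]
    constructor
    · rintro ⟨j, hj, h⟩
      exact ⟨j, by omega, by rwa [List.getElem_map] at h⟩
    · rintro ⟨j, hj, h⟩
      exact ⟨j, by rw [List.length_map]; omega, by rwa [List.getElem_map]⟩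
  -- As vertices do not repeat within a constraint, the earlier occurrence that set the flag must be
  -- of the other endpoint.
  have hne : ∀ j (hj : j < i), (O.order[j] : ℕ) ≠ O.order[i] := by
    intro j hj h
    have := (O.nodup.getElem_inj_iff).1 (Fin.val_injective h)
    omega
  rw [hmem, hmem]
  simp only [Sym2.eq_iff]
  constructor
  · rintro ⟨-, rfl | rfl, ⟨j, hj, h⟩ | ⟨j, hj, h⟩⟩
    · exact absurd h (hne j hj)
    · exact ⟨j, hj, Or.inr ⟨h, rfl⟩⟩
    · exact ⟨j, hj, Or.inl ⟨h, rfl⟩⟩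
    · exact absurd h (hne j hj)
  · rintro ⟨j, hj, ⟨h, h'⟩ | ⟨h, h'⟩⟩
    · exact ⟨h1, Or.inr h', Or.inl ⟨j, hj, h⟩⟩
    · exact ⟨h1, Or.inl h', Or.inr ⟨j, hj, h⟩⟩

/-- The offset `k = 0` is the size entry of the block, and `k = i + 1` is its `i`-th vertex. -/
theorem exists_block (I : NetInstance n) : ∀ q < (encodeConstraints I).length,
    ∃ I₁ O I₂ k, I = I₁ ++ O :: I₂ ∧ k ≤ O.order.length ∧
      q = (encodeConstraints I₁).length + k := by
  induction I with
  | nil => intro q hq; simp [encodeConstraints] at hq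
  | cons O I ih =>
    intro q hq
    by_cases h : q ≤ O.order.length
    · exact ⟨[], O, I, q, rfl, h, by simp [encodeConstraints]⟩
    · have hlen : (encodeConstraint O).length = O.order.length + 1 := by simp [encodeConstraint]
      rw [encodeConstraints_cons, List.length_append] at hq
      obtain ⟨I₁, O', I₂, k, rfl, hk, hq'⟩ := ih (q - (O.order.length + 1)) (by omega)
      refine ⟨O :: I₁, O', I₂, k, rfl, hk, ?_⟩
      rw [encodeConstraints_cons, List.length_append]
      omega

theorem exists_position_of_mem_hits {p : ℕ} {e : ℕ × ℕ} (hp : p ∈ hits (encodeInstance I) e) :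
    ∃ I₁ O I₂ i, I = I₁ ++ O :: I₂ ∧ i < O.order.length ∧ p = position I₁ i := by
  simp only [hits, Finset.mem_filter, Finset.mem_range] at hp
  obtain ⟨hlt, h2, h0, -⟩ := hp
  rw [encodeInstance_eq, List.length_cons, List.length_cons] at hlt
  obtain ⟨I₁, O, I₂, k, hI, hk, hq⟩ := exists_block I (p - 2) (by omega)
  rcases Nat.eq_zero_or_pos k with rfl | hk0
  · refine absurd (scanState_start hI e.1 e.2) ?_
    rwa [show 2 + (encodeConstraints I₁).length = p by omega]
  · exact ⟨I₁, O, I₂, k - 1, hI, by omega, by unfold position; omega⟩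

/-! ### Graphs and covers -/

/-- The pair of endpoints of an edge, in decreasing order. -/
def edgePair (e : Sym2 (Fin n)) : ℕ × ℕ := (e.sup, e.inf)

theorem sym2_edgePair (a b : Fin n) :
    s((edgePair s(a, b)).1, (edgePair s(a, b)).2) = s((a : ℕ), (b : ℕ)) := by
  rcases le_total a b with h | h <;> simp [edgePair, h, Sym2.eq_swap]

theorem isPair_edgePair {a b : Fin n} (h : a ≠ b) : IsPair n (edgePair s(a, b)) := by
  refine ⟨?_, Fin.is_lt _⟩
  rcases lt_or_gt_of_ne h with h | h <;> simpa [edgePair, h.le] using h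

theorem position_mem_hits_edgePair (hI : I = I₁ ++ O :: I₂) {i j : ℕ} (hj : j < i)
    (hi : i < O.order.length) (hne : O.order[j] ≠ O.order[i]) :
    position I₁ i ∈ hits (encodeInstance I) (edgePair s(O.order[j], O.order[i])) :=
  (position_mem_hits hI hi (isPair_edgePair hne).1.ne').2 ⟨j, hj, (sym2_edgePair _ _).symm⟩

/-- The edges of a solution form a cover. -/
theorem covers_of_isSolution {G : SimpleGraph (Fin n)} (hG : IsSolution I G) :
    ∃ E, Covers n (hits (encodeInstance I)) E ∧ E.card ≤ numEdges G := by
  classical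
  refine ⟨G.edgeFinset.image edgePair, ⟨?_, ?_⟩, ?_⟩
  · intro e he
    obtain ⟨f, hf, rfl⟩ := Finset.mem_image.1 he
    induction f with
    | h a b => exact isPair_edgePair (G.ne_of_adj (by simpa using hf))
  · rintro ⟨u, v⟩ he p hp
    obtain ⟨I₁, O, I₂, i, hI, hi, rfl⟩ := exists_position_of_mem_hits hp
    obtain ⟨j, hj, -⟩ := (position_mem_hits hI hi he.1.ne').1 hp
    -- The requirement does not belong to a first vertex, so the solution has an edge to an earlier
    -- vertex, and that edge meets it.
    obtain ⟨⟨k, hk⟩, hki, hadj⟩ := hG O (by simp [hI]) ⟨i, hi⟩ (Nat.zero_lt_of_lt hj)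
    refine ⟨_, Finset.mem_image_of_mem edgePair (SimpleGraph.mem_edgeFinset.2 (G.mem_edgeSet.2 hadj)), ?_⟩
    exact position_mem_hits_edgePair hI hki hi hadj.ne
  · refine Finset.card_image_le.trans ?_
    rw [numEdges, Set.ncard_eq_toFinset_card', SimpleGraph.edgeFinset]

/-- The graph whose edges are the chosen pairs. -/
def graphOf (L : List (Fin n × Fin n)) : SimpleGraph (Fin n) :=
  SimpleGraph.fromEdgeSet {e | e ∈ L.map fun e => s(e.1, e.2)}

variable {L : List (Fin n × Fin n)}

theorem mem_edgeSet_graphOf (hL : ∀ e ∈ L, e.2 < e.1) (e : Sym2 (Fin n)) :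
    e ∈ (graphOf L).edgeSet ↔ e ∈ L.map fun e => s(e.1, e.2) := by
  rw [graphOf, SimpleGraph.edgeSet_fromEdgeSet, Set.mem_sdiff]
  refine and_iff_left_of_imp fun he => ?_
  obtain ⟨f, hf, rfl⟩ := List.mem_map.1 he
  simpa using (hL f hf).ne'

theorem listsEdges_graphOf (hL : ∀ e ∈ L, e.2 < e.1) (hnd : L.Nodup) :
    ListsEdges (L.flatMap fun e => [(e.1 : ℕ), (e.2 : ℕ)]) (graphOf L) := by
  refine ⟨L, rfl, hnd.map_on ?_, mem_edgeSet_graphOf hL⟩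
  rintro ⟨a, b⟩ hab ⟨c, d⟩ hcd h
  have h1 := hL _ hab
  have h2 := hL _ hcd
  rcases Sym2.eq_iff.1 h with ⟨rfl, rfl⟩ | ⟨rfl, rfl⟩
  · rfl
  · exact absurd h1 h2.asymm

theorem numEdges_graphOf_le (hL : ∀ e ∈ L, e.2 < e.1) : numEdges (graphOf L) ≤ L.length := by
  classical
  have h : (graphOf L).edgeSet = ((L.map fun e => s(e.1, e.2)).toFinset : Set (Sym2 (Fin n))) := by
    ext e
    rw [mem_edgeSet_graphOf hL, List.coe_toFinset, Set.mem_ofPred_eq]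
  rw [numEdges, h, Set.ncard_coe_finset]
  exact (List.toFinset_card_le _).trans (List.length_map _).le

theorem isSolution_graphOf (hL : ∀ e ∈ L, e.2 < e.1)
    (hcov : ∀ e, IsPair n e → ∀ p ∈ hits (encodeInstance I) e,
      ∃ f ∈ L, p ∈ hits (encodeInstance I) (f.1, f.2)) : IsSolution I (graphOf L) := by
  rintro O hO ⟨i, hi⟩ (h0 : 0 < i)
  obtain ⟨I₁, I₂, hI⟩ := List.append_of_mem hO
  -- The pair of the first and the `i`-th vertex shows that this requirement can be met, so some
  -- chosen pair meets it.
  have hne : O.order[0] ≠ O.order[i] := fun h => h0.ne ((O.nodup.getElem_inj_iff).1 h)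
  obtain ⟨f, hf, hp⟩ := hcov _ (isPair_edgePair hne) _ (position_mem_hits_edgePair hI h0 hi hne)
  obtain ⟨j, hj, h⟩ := (position_mem_hits hI hi (Fin.val_ne_of_ne (hL f hf).ne')).1 hp
  refine ⟨⟨j, hj.trans hi⟩, hj, ?_⟩
  rw [← SimpleGraph.mem_edgeSet, mem_edgeSet_graphOf hL]
  refine List.mem_map.2 ⟨f, hf, ?_⟩
  rw [Sym2.eq_iff] at h ⊢
  simp only [← Fin.ext_iff] at h
  simp only [List.get_eq_getElem]
  tauto

end NetCon

namespace NetCon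

/-! ### The approximation ratio and the running time -/

variable {n : ℕ} {I : NetInstance n}

theorem length_encodeInstance (I : NetInstance n) :
    (encodeInstance I).length = 2 + I.length + (I.map fun O => O.order.length).sum := by
  rw [encodeInstance_eq, List.length_cons, List.length_cons]
  suffices h : (encodeConstraints I).length =
      I.length + (I.map fun O => O.order.length).sum by omega
  induction I with
  | nil => rfl
  | cons O I ih =>
    rw [encodeConstraints_cons, List.length_append, ih, encodeConstraint]
    simp only [List.length_cons, List.length_map, List.map_cons, List.sum_cons]
    omega

theorem length_le_sum (I : NetInstance n) :
    I.length ≤ (I.map fun O => O.order.length).sum := by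
  have h := List.card_nsmul_le_sum (I.map fun O => O.order.length) 1 (by
    intro x hx
    obtain ⟨O, -, rfl⟩ := List.mem_map.1 hx
    exact (Nat.le_succ 1).trans O.two_le)
  simpa using h

theorem sum_le_length_mul (I : NetInstance n) :
    (I.map fun O => O.order.length).sum ≤ I.length * n := by
  have h := List.sum_le_card_nsmul (I.map fun O => O.order.length) n (by
    intro x hx
    obtain ⟨O, -, rfl⟩ := List.mem_map.1 hx
    simpa using O.nodup.length_le_card)
  simpa using h

theorem length_encodeInstance_le_size (I : NetInstance n) :
    (encodeInstance I).length ≤ 2 * instanceSize I + 2 := by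
  have h1 := length_encodeInstance I
  have h2 := length_le_sum I
  unfold instanceSize
  omega

theorem opt_nil : opt ([] : NetInstance n) = 0 := by
  refine Nat.le_zero.1 (Nat.sInf_le ⟨⊥, ?_, ?_⟩)
  · intro O hO
    simp at hO
  · simp [numEdges]

/-- The logarithmic factor of the greedy algorithm. -/
theorem one_add_log_length_le (hI : I ≠ []) :
    1 + Real.log (encodeInstance I).length ≤ 5 * (Real.log I.length + Real.log n) := by
  have hr : 0 < I.length := List.length_pos_iff.2 hI
  obtain ⟨O, hO⟩ := List.exists_mem_of_ne_nil I hI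
  have hn : 2 ≤ n := O.two_le.trans (by simpa using O.nodup.length_le_card)
  -- The length is at most `2 + r + r * n`, and both `2` and `r` are at most `r * n`.
  have hle : (encodeInstance I).length ≤ 4 * (I.length * n) := by
    have h1 := length_encodeInstance I
    have h2 := sum_le_length_mul I
    have h3 := Nat.mul_le_mul hr.nat_succ_le hn
    have h4 := Nat.mul_le_mul_left I.length hn
    omega
  have hpos : 0 < (encodeInstance I).length := by
    rw [length_encodeInstance]
    omega
  have hr' : (I.length : ℝ) ≠ 0 := by exact_mod_cast hr.ne'
  have hn' : (n : ℝ) ≠ 0 := by positivity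
  have h1 : Real.log (encodeInstance I).length ≤
      Real.log 4 + (Real.log I.length + Real.log n) := by
    rw [← Real.log_mul hr' hn', ← Real.log_mul (by norm_num) (mul_ne_zero hr' hn')]
    exact Real.log_le_log (by exact_mod_cast hpos) (by exact_mod_cast hle)
  have h2 : Real.log 4 = 2 * Real.log 2 := by
    rw [show (4 : ℝ) = 2 ^ 2 by norm_num, Real.log_pow]
    norm_num
  have h3 : Real.log 2 ≤ Real.log n := Real.log_le_log (by norm_num) (by exact_mod_cast hn)
  have h4 : 0 ≤ Real.log I.length := Real.log_natCast_nonneg _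
  -- Since `log 2 > 1/2`, the constant `1 + log 4` is at most `4 * log 2`, hence at most `4 * log
  -- n`.
  have h5 := Real.log_two_gt_d9
  linarith

theorem harmonic_le_of_le {a b : ℕ} (h : a ≤ b) : (harmonic a : ℝ) ≤ 1 + Real.log b := by
  refine (harmonic_le_one_add_log a).trans ?_
  rcases Nat.eq_zero_or_pos a with rfl | ha
  · simpa using Real.log_natCast_nonneg b
  · have := Real.log_le_log (by exact_mod_cast ha) (Nat.cast_le (α := ℝ).2 h)
    linarith

/-- The number of pairs chosen by the greedy algorithm. -/
theorem length_le_mul_opt {D S : Finset ℕ} {t : ℕ} {L : List (ℕ × ℕ)}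
    (hg : Greedy n (hits (encodeInstance I)) D t S L) (hD : D.card ≤ (encodeInstance I).length) :
    (L.length : ℝ) ≤ 5 * (Real.log I.length + Real.log n) * opt I := by
  obtain ⟨G, hG, hopt⟩ := exists_optimal_solution I
  obtain ⟨E, hE, hcard⟩ := covers_of_isSolution hG
  rw [hopt] at hcard
  have h1 := hg.length_le E hE
  have h2 : (L.length : ℚ) ≤ E.card * harmonic D.card := by
    have h3 : (0 : ℚ) ≤ harmonic (D \ S).card :=
      Finset.sum_nonneg fun i _ => by positivity
    nlinarith [mul_nonneg (Nat.cast_nonneg (α := ℚ) E.card) h3]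
  have h3 : (L.length : ℝ) ≤ E.card * harmonic D.card := by exact_mod_cast h2
  -- Without constraints the logarithmic bound is unavailable, but then the cover is empty, so no
  -- pair is chosen.
  by_cases hI : I = []
  · subst hI
    rw [opt_nil] at hcard ⊢
    rw [Nat.le_zero.1 hcard] at h3
    simpa using h3
  · have h4 := (harmonic_le_of_le hD).trans (one_add_log_length_le hI)
    have h5 : (E.card : ℝ) ≤ opt I := by exact_mod_cast hcard
    have h6 : (0 : ℝ) ≤ harmonic D.card := by
      exact_mod_cast Finset.sum_nonneg fun i _ => by positivity
    calc (L.length : ℝ) ≤ E.card * harmonic D.card := h3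
      _ ≤ opt I * (5 * (Real.log I.length + Real.log n)) := by gcongr
      _ = _ := mul_comm _ _

/-- A bound for the running time in terms of the size of the instance. -/
noncomputable def timeBound : Polynomial ℕ :=
  (2 * .X + 2) * (.X * (.X * (26 * (2 * .X + 2) + 7) + 4) + 4) + 4

theorem exists_fin_list {L : List (ℕ × ℕ)} (h : ∀ e ∈ L, IsPair n e) :
    ∃ L' : List (Fin n × Fin n), L'.map (fun e => ((e.1 : ℕ), (e.2 : ℕ))) = L := by
  refine ⟨L.pmap (fun e he => (⟨e.1, he.2⟩, ⟨e.2, he.1.trans he.2⟩)) h, ?_⟩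
  rw [List.map_pmap]
  simp

theorem greedyProgram_spec (n : ℕ) (I : NetInstance n) :
    ∃ (w : List ℕ) (G : SimpleGraph (Fin n)),
      ComputesWithin greedyProgram (encodeInstance I) w (timeBound.eval (instanceSize I)) ∧
      ListsEdges w G ∧ IsSolution I G ∧
      (numEdges G : ℝ) ≤ 5 * (Real.log I.length + Real.log n) * opt I := by
  classical
  -- The universe of the set cover instance: all positions that some pair meets.
  let D := (Finset.range (encodeInstance I).length).filter fun p =>
    ∃ e, IsPair n e ∧ p ∈ hits (encodeInstance I) e
  have hD : ∀ p, p ∈ D ↔ ∃ e, IsPair n e ∧ p ∈ hits (encodeInstance I) e := by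
    intro p
    rw [Finset.mem_filter, and_iff_right_iff_imp]
    rintro ⟨e, -, hp⟩
    exact (Finset.mem_filter.1 hp).1
  have hDcard : D.card ≤ (encodeInstance I).length := by
    simpa using Finset.card_filter_le (Finset.range (encodeInstance I).length) _
  obtain ⟨s, t, hexec, ⟨S, L, hout, hg⟩, ht⟩ := wp_greedyProgram (w := encodeInstance I) (n := n)
    (by rw [length_encodeInstance]; omega) rfl hD
  obtain ⟨L', rfl⟩ := exists_fin_list hg.isPair
  have hlt : ∀ e ∈ L', e.2 < e.1 := fun e he => (hg.isPair _ (List.mem_map_of_mem he)).1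
  refine ⟨_, graphOf L', ⟨s, t, hexec, ht.trans ?_, hout⟩, ?_, ?_, ?_⟩
  · have hn : n ≤ instanceSize I := Nat.le_add_right _ _
    have hlen := length_encodeInstance_le_size I
    simp only [timeBound, Polynomial.eval_add, Polynomial.eval_mul, Polynomial.eval_X,
      Polynomial.eval_ofNat]
    gcongr
  · rw [pairWord, List.flatMap_map]
    exact listsEdges_graphOf hlt hg.nodup.of_map
  · refine isSolution_graphOf hlt fun e he p hp => ?_
    obtain ⟨f, hf, hpf⟩ := hg.covered he hp
    obtain ⟨f', hf', rfl⟩ := List.mem_map.1 hf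
    exact ⟨f', hf', hpf⟩
  · refine le_trans ?_ (length_le_mul_opt hg hDcard)
    rw [List.length_map]
    exact_mod_cast numEdges_graphOf_le hlt

end NetCon

theorem mainTheorem2 :
    ∃ C : ℝ, 0 < C ∧ ∃ P : NetCon.RamProgram,
      NetCon.IsPolyTimeApproximation P (fun n r => C * (Real.log r + Real.log n)) :=
  ⟨5, by norm_num, NetCon.greedyProgram, NetCon.timeBound, NetCon.greedyProgram_spec⟩
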